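/- **Setting.** Let $\mathcal X$ be a set, $\mathcal Y$ a real Hilbert space, $k:\mathcal X\times\mathcal X\to\mathbb R$ such that $\mathcal K(x,x')=k(x,x')\,\mathbf I_{\mathcal Y}$ is an operator-valued kernel, and $\mathcal H_{\mathcal K}$ the vector-valued reproducing kernel Hilbert space of functions $\mathcal X\to\mathcal Y$ with reproducing kernel $\mathcal K$. Let $n\ge 1$, $(x_i,y_i)_{i\le n}\in(\mathcal X\times\mathcal Y)^n$ and $\Lambda>0$. Put $K^X=[k(x_i,x_j)]_{i,j}$ and $K^Y=[\langle y_i,y_j\rangle_{\mathcal Y}]_{i,j}$. For a real matrix $M$, $\|M\|_{2,q}$ is the $\ell_q$ norm of the vector of Euclidean norms of the rows of $M$. **Losses.** For $\epsilon>0$, $\|u\|_{\mathcal Y,\epsilon}=\inf_{\|d\|\le\epsilon}\|u-d\|=\max(\|u\|-\epsilon,0)$ and $\|u\|^2_{\mathcal Y,\epsilon}=\inf_{\|d\|\le\epsilon}\|u-d\|^2=\max(\|u\|-\epsilon,0)^2$. For $\kappa>0$, $\ell_{H,\kappa}(u)=\inf_{z\in\mathcal Y}\big(\kappa\|z\|+\tfrac12\|u-z\|^2\big)$,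 which equals $\tfrac12\|u\|^2$ if $\|u\|\le\kappa$ and $\kappa(\|u\|-\tfrac{\kappa}{2})$ otherwise. **Theorem.** Let $V\in\mathbb R^{n\times n}$ be invertible with $VV^\top=K^Y$. Consider the primal problems ($\epsilon$-insensitive Ridge, $\kappa$-Huber and $\epsilon$-SVR) $$(P1)\ \min_{h\in\mathcal H_{\mathcal K}}\frac1{2n}\sum_{i=1}^n\|h(x_i)-y_i\|^2_{\mathcal Y,\epsilon}+\frac\Lambda2\|h\|^2_{\mathcal H_{\mathcal K}},$$ $$(P2)\ \min_{h\in\mathcal H_{\mathcal K}}\frac1n\sum_{i=1}^n\ell_{H,\kappa}(h(x_i)-y_i)+\frac\Lambda2\|h\|^2_{\mathcal H_{\mathcal K}},$$ $$(P3)\ \min_{h\in\mathcal H_{\mathcal K}}\frac1n\sum_{i=1}^n\|h(x_i)-y_i\|_{\mathcal Y,\epsilon}+\frac\Lambda2\|h\|^2_{\mathcal H_{\mathcal K}},$$ and the respective finite-dimensional problems $$(D1)\ \min_{W\in\mathbb R^{n\times n}}\tfrac12\|AW-B\|_{\mathrm{Fro}}^2+\epsilon\|W\|_{2,1},$$ $$(D2)\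 \min_{W\in\mathbb R^{n\times n}}\tfrac12\|AW-B\|_{\mathrm{Fro}}^2\quad\text{s.t. }\|W\|_{2,\infty}\le\kappa,$$ $$(D3)\ \min_{W\in\mathbb R^{n\times n}}\tfrac12\|AW-B\|_{\mathrm{Fro}}^2+\epsilon\|W\|_{2,1}\quad\text{s.t. }\|W\|_{2,\infty}\le1,$$ where $A,B\in\mathbb R^{m\times n}$ (for any $m$, in particular $m=n$) are any matrices such that $A^\top B=V$ and $A^\top A=\frac{K^X}{\Lambda n}+\mathbf I_n$ for $(D1)$ and $(D2)$, respectively $A^\top A=\frac{K^X}{\Lambda n}$ for $(D3)$. Then, for each $q\in\{1,2,3\}$, every $\epsilon,\kappa>0$ and every such $A,B$, problem $(Dq)$ has a unique solution $\hat W$, and, with $\hat\Omega=[\hat\omega_{ij}]=\hat WV^{-1}$, the unique solution of $(Pq)$ is $$\hat h=\frac1{\Lambda n}\sum_{i,j=1}^n\mathcal K(\cdot,x_i)\,\hat\omega_{ij}\,y_j .$$ -/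

import Mathlib

open scoped ENNReal InnerProductSpace

noncomputable section

namespace DualOVK

/-! ### Optimisation problems -/

/-- `a` is a solution of the problem `min_{b ∈ S} f b`. -/
def IsSolution {α : Type*} (f : α → ℝ) (S : Set α) (a : α) : Prop :=
  a ∈ S ∧ IsMinOn f S a

/-! ### Loss functions on a normed space -/

section Losses

variable {Y : Type*} [NormedAddCommGroup Y] [InnerProductSpace ℝ Y]

/-- The infimal convolution `(f □ g)(y) = inf_z f z + g (y - z)` of two real-valued functions.
It is used for nonnegative functions only, for which the infimum is that of a set bounded below. -/
def infConv (f g : Y → ℝ) (y : Y) : ℝ :=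
  ⨅ z : Y, f z + g (y - z)

/-- The `ε`-insensitive version of a loss `ℓ ≥ 0`: the infimal convolution of `ℓ` with the
characteristic function (`0` inside, `+∞` outside) of the closed ball of radius `ε` at the origin,
i.e. the infimum of `ℓ` over the closed ball of radius `ε` centred at `y`. -/
def epsInsensitive (ℓ : Y → ℝ) (ε : ℝ) (y : Y) : ℝ :=
  ⨅ d : Metric.closedBall (0 : Y) ε, ℓ (y - d)

/-- The loss `‖·‖_{Y,ε}` of `ε`-SVR. -/
def svrLoss (ε : ℝ) : Y → ℝ :=
  epsInsensitive (fun y => ‖y‖) ε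

/-- The loss `‖·‖²_{Y,ε}` of `ε`-insensitive Ridge regression. -/
def ridgeLoss (ε : ℝ) : Y → ℝ :=
  epsInsensitive (fun y => ‖y‖ ^ 2) ε

/-- The Huber loss of parameter `κ`. -/
def huberLoss (κ : ℝ) : Y → ℝ :=
  infConv (fun y => κ * ‖y‖) (fun y => 1 / 2 * ‖y‖ ^ 2)

theorem exists_shrink {ε : ℝ} (hε : 0 ≤ ε) (y : Y) :
    ∃ d : Metric.closedBall (0 : Y) ε, ‖y - d‖ = max (‖y‖ - ε) 0 := by
  rcases le_or_gt ‖y‖ ε with h | h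
  · refine ⟨⟨y, by simpa using h⟩, ?_⟩
    simp [h]
  · have hy : 0 < ‖y‖ := hε.trans_lt h
    refine ⟨⟨(ε / ‖y‖) • y, ?_⟩, ?_⟩
    · rw [mem_closedBall_zero_iff, norm_smul, Real.norm_of_nonneg (by positivity)]
      field_simp
      exact le_rfl
    · have h1 : y - (ε / ‖y‖) • y = (1 - ε / ‖y‖) • y := by
        rw [sub_smul, one_smul]
      have h2 : 0 ≤ 1 - ε / ‖y‖ := by
        rw [sub_nonneg, div_le_one hy]
        exact h.le
      rw [max_eq_left (by linarith)]
      change ‖y - (ε / ‖y‖) • y‖ = _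
      rw [h1, norm_smul, Real.norm_of_nonneg h2]
      field_simp

theorem shrink_le {Y : Type*} [NormedAddCommGroup Y] {ε : ℝ} (y : Y) (d : Metric.closedBall (0 : Y) ε) :
    max (‖y‖ - ε) 0 ≤ ‖y - d‖ := by
  have hd : ‖(d : Y)‖ ≤ ε := mem_closedBall_zero_iff.1 d.2
  have := norm_sub_norm_le y d
  exact max_le (by linarith) (norm_nonneg _)

/-- Closed form of the `ε`-SVR loss. -/
theorem svrLoss_eq {ε : ℝ} (hε : 0 ≤ ε) (y : Y) : svrLoss ε y = max (‖y‖ - ε) 0 := by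
  obtain ⟨d, hd⟩ := exists_shrink hε y
  have : Nonempty (Metric.closedBall (0 : Y) ε) := ⟨d⟩
  refine le_antisymm ?_ (le_ciInf fun d => shrink_le y d)
  rw [← hd]
  exact ciInf_le (f := fun d : Metric.closedBall (0 : Y) ε => ‖y - d‖)
    ⟨0, by rintro _ ⟨e, rfl⟩; exact norm_nonneg _⟩ d

/-- Closed form of the `ε`-insensitive Ridge loss. -/
theorem ridgeLoss_eq {ε : ℝ} (hε : 0 ≤ ε) (y : Y) :
    ridgeLoss ε y = max (‖y‖ - ε) 0 ^ 2 := by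
  obtain ⟨d, hd⟩ := exists_shrink hε y
  have : Nonempty (Metric.closedBall (0 : Y) ε) := ⟨d⟩
  refine le_antisymm ?_ (le_ciInf fun d =>
    pow_le_pow_left₀ (le_max_right _ _) (shrink_le y d) 2)
  rw [← hd]
  exact ciInf_le (f := fun d : Metric.closedBall (0 : Y) ε => ‖y - d‖ ^ 2)
    ⟨0, by rintro _ ⟨e, rfl⟩; positivity⟩ d

/-- Closed form of the Huber loss. -/
theorem huberLoss_eq {κ : ℝ} (hκ : 0 ≤ κ) (y : Y) :
    huberLoss κ y = if ‖y‖ ≤ κ then 1 / 2 * ‖y‖ ^ 2 else κ * (‖y‖ - κ / 2) := by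
  have hbdd : BddBelow (Set.range fun z : Y => κ * ‖z‖ + 1 / 2 * ‖y - z‖ ^ 2) :=
    ⟨0, by rintro _ ⟨e, rfl⟩; positivity⟩
  refine le_antisymm ?_ (le_ciInf fun z => ?_)
  · split_ifs with h
    · refine (ciInf_le hbdd 0).trans (le_of_eq ?_)
      simp
    · push Not at h
      have hy : 0 < ‖y‖ := hκ.trans_lt h
      have h2 : 0 ≤ 1 - κ / ‖y‖ := by
        rw [sub_nonneg, div_le_one hy]
        exact h.le
      refine (ciInf_le hbdd ((1 - κ / ‖y‖) • y)).trans (le_of_eq ?_)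
      have h1 : y - (1 - κ / ‖y‖) • y = (κ / ‖y‖) • y := by
        rw [sub_smul, one_smul, sub_sub_cancel]
      change κ * ‖(1 - κ / ‖y‖) • y‖ + 1 / 2 * ‖y - (1 - κ / ‖y‖) • y‖ ^ 2 = _
      rw [h1, norm_smul, norm_smul, Real.norm_of_nonneg h2,
        Real.norm_of_nonneg (show 0 ≤ κ / ‖y‖ by positivity)]
      field_simp
      ring
  · have h1 : ‖y‖ ≤ ‖z‖ + ‖y - z‖ := by
      simpa using norm_add_le z (y - z)
    have hz := norm_nonneg z
    have hyz := norm_nonneg (y - z)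
    have hy := norm_nonneg y
    change _ ≤ κ * ‖z‖ + 1 / 2 * ‖y - z‖ ^ 2
    split_ifs with h
    · rcases le_or_gt ‖y‖ ‖y - z‖ with h3 | h3 <;> nlinarith
    · nlinarith [sq_nonneg (‖y - z‖ - κ)]

end Losses

/-! ### Matrix norms and the finite-dimensional problems -/

/-- The Frobenius norm of a real matrix. -/
def frobNorm {m n : Type*} [Fintype m] [Fintype n] (M : Matrix m n ℝ) : ℝ :=
  letI := Matrix.frobeniusNormedAddCommGroup (m := m) (n := n) (α := ℝ)
  ‖M‖

/-- The row-wise mixed norm `‖M‖_{p,q}`: the `ℓ_q` norm of the vector of `ℓ_p` norms of the rows. -/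
def mixedNorm {m n : Type*} [Fintype m] [Fintype n] (p q : ℝ≥0∞) (M : Matrix m n ℝ) : ℝ :=
  ‖WithLp.toLp q (fun i => ‖WithLp.toLp p (M i)‖)‖

/-- The least-squares objective `½ ‖A W - B‖²_Fro`. -/
def leastSquares {m n : ℕ} (A B : Matrix (Fin m) (Fin n) ℝ) (W : Matrix (Fin n) (Fin n) ℝ) : ℝ :=
  1 / 2 * frobNorm (A * W - B) ^ 2

/-- The multi-task Lasso objective `½ ‖A W - B‖²_Fro + ε ‖W‖_{2,1}`. -/
def multiTaskLasso {m n : ℕ} (ε : ℝ) (A B : Matrix (Fin m) (Fin n) ℝ)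
    (W : Matrix (Fin n) (Fin n) ℝ) : ℝ :=
  1 / 2 * frobNorm (A * W - B) ^ 2 + ε * mixedNorm 2 1 W

/-- The constraint set `‖W‖_{2,∞} ≤ r`. -/
def rowBall (n : ℕ) (r : ℝ) : Set (Matrix (Fin n) (Fin n) ℝ) :=
  {W | mixedNorm 2 ∞ W ≤ r}

/-! ### Gram matrices, empirical risk and double expansion -/

/-- The input Gram matrix `[k (x_i, x_j)]`. -/
def inputGram {X : Type*} {n : ℕ} (k : X → X → ℝ) (x : Fin n → X) : Matrix (Fin n) (Fin n) ℝ :=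
  Matrix.of fun i j => k (x i) (x j)

/-- The output Gram matrix `[⟪y_i, y_j⟫]`. -/
def outputGram {Y : Type*} [NormedAddCommGroup Y] [InnerProductSpace ℝ Y] {n : ℕ}
    (y : Fin n → Y) : Matrix (Fin n) (Fin n) ℝ :=
  Matrix.of fun i j => ⟪y i, y j⟫_ℝ

/-- The regularised empirical risk `(1/n) ∑ ℓ (h x_i - y_i) + (Λ/2) ‖h‖²`. -/
def regRisk {X Y H : Type*} [NormedAddCommGroup Y] [InnerProductSpace ℝ Y]
    [NormedAddCommGroup H] [InnerProductSpace ℝ H] [RKHS ℝ H X Y] {n : ℕ}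
    (ℓ : Y → ℝ) (Λ : ℝ) (x : Fin n → X) (y : Fin n → Y) (h : H) : ℝ :=
  1 / (n : ℝ) * ∑ i, ℓ (h (x i) - y i) + Λ / 2 * ‖h‖ ^ 2

/-- The double expansion `(1/(Λ n)) ∑_{i,j} 𝒦(·, x_i) ω_{ij} y_j`, as an element of the vv-RKHS;
`RKHS.kerFun H s v` is the function `𝒦(·, s) v`. -/
def doubleExpansion {X Y : Type*} [NormedAddCommGroup Y] [InnerProductSpace ℝ Y]
    [CompleteSpace Y] (H : Type*) [NormedAddCommGroup H] [InnerProductSpace ℝ H]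
    [CompleteSpace H] [RKHS ℝ H X Y] {n : ℕ} (Λ : ℝ) (x : Fin n → X) (y : Fin n → Y)
    (Ω : Matrix (Fin n) (Fin n) ℝ) : H :=
  (1 / (Λ * n)) • ∑ i, ∑ j, RKHS.kerFun H (x i) (Ω i j • y j)

end DualOVK

end

open scoped ENNReal InnerProductSpace
open Filter Bornology

noncomputable section

namespace DualOVK

section PenalizedLeastSquares

variable {E F : Type*} [NormedAddCommGroup E] [NormedSpace ℝ E]
  [NormedAddCommGroup F] [InnerProductSpace ℝ F]

/-- Variational inequality at a minimiser of a least-squares objective with a convex penalty. -/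
theorem IsSolution.inner_le_of_leastSquares {L : E →ₗ[ℝ] F} {b : F} {φ : E → ℝ} {S : Set E}
    (hφ : ConvexOn ℝ S φ) {w : E}
    (hw : IsSolution (fun w => 1 / 2 * ‖L w - b‖ ^ 2 + φ w) S w) {w' : E} (hw' : w' ∈ S) :
    ⟪b - L w, L (w' - w)⟫_ℝ ≤ φ w' - φ w := by
  by_contra! hlt
  set a := ⟪b - L w, L (w' - w)⟫_ℝ - (φ w' - φ w) with ha
  have ha0 : 0 < a := by linarith
  set N := ‖L (w' - w)‖ ^ 2 with hN
  have hN0 : 0 ≤ N := by positivity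
  have key : ∀ t : ℝ, 0 < t → t ≤ 1 → a ≤ t / 2 * N := by
    intro t ht ht1
    have hmem : (1 - t) • w + t • w' ∈ S := hφ.1 hw.1 hw' (by linarith) ht.le (by ring)
    have h1 := hw.2 hmem
    have h2 := hφ.2 hw.1 hw' (by linarith : 0 ≤ 1 - t) ht.le (by ring)
    have h3 : L ((1 - t) • w + t • w') - b = t • L (w' - w) - (b - L w) := by
      simp only [map_add, map_smul, map_sub]
      module
    simp only [Set.mem_ofPred_eq, h3, smul_eq_mul] at h1 h2
    rw [norm_sub_rev (L w) b, norm_sub_sq_real (t • L (w' - w)), inner_smul_left, norm_smul, mul_pow,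
      Real.norm_of_nonneg ht.le, real_inner_comm] at h1
    simp only [conj_trivial] at h1
    have h4 : t * a ≤ t * (t / 2 * N) := by
      rw [ha, hN]
      nlinarith
    exact le_of_mul_le_mul_left h4 ht
  have h5 := key (min 1 (a / (N + 1))) (by positivity) (min_le_left _ _)
  have h6 : min 1 (a / (N + 1)) * N ≤ a / (N + 1) * N :=
    mul_le_mul_of_nonneg_right (min_le_right _ _) hN0
  have h7 : a / (N + 1) * N ≤ a := by
    rw [div_mul_eq_mul_div, div_le_iff₀ (by positivity)]
    nlinarith
  linarith

/-- A least-squares objective with injective design and a convex, continuous, nonnegative penalty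
has a unique minimiser on a nonempty closed convex set. -/
theorem existsUnique_isSolution_leastSquares_add [FiniteDimensional ℝ E] {L : E →ₗ[ℝ] F}
    (hL : Function.Injective L) (b : F) {φ : E → ℝ} {S : Set E} (hS : IsClosed S)
    (hne : S.Nonempty) (hφ : ConvexOn ℝ S φ) (hφc : Continuous φ) (hφ0 : ∀ w, 0 ≤ φ w) :
    ∃! w, IsSolution (fun w => 1 / 2 * ‖L w - b‖ ^ 2 + φ w) S w := by
  have : ProperSpace E := FiniteDimensional.proper_real E
  obtain ⟨w₀, hw₀⟩ := hne
  have hLc : Continuous L := L.continuous_of_finiteDimensional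
  obtain ⟨K, -, hK⟩ := L.exists_antilipschitzWith (LinearMap.ker_eq_bot.2 hL)
  have h1 : Tendsto (fun w => ‖L w‖ - ‖b‖) (cocompact E) atTop := by
    rw [← Metric.cobounded_eq_cocompact]
    exact tendsto_atTop_add_const_right _ _ (tendsto_norm_cobounded_atTop.comp hK.tendsto_cobounded)
  have h2 : Tendsto (fun w => 1 / 2 * ‖L w - b‖ ^ 2 + φ w) (cocompact E) atTop := by
    have h3 : Tendsto (fun w => ‖L w - b‖) (cocompact E) atTop :=
      tendsto_atTop_mono (fun w => norm_sub_norm_le _ _) h1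
    refine tendsto_atTop_mono (fun w => le_add_of_nonneg_right (hφ0 w)) ?_
    exact ((tendsto_pow_atTop two_ne_zero).comp h3).const_mul_atTop (by norm_num)
  have hcont : Continuous fun w => 1 / 2 * ‖L w - b‖ ^ 2 + φ w := by fun_prop
  obtain ⟨w, hwS, hw⟩ := hcont.continuousOn.exists_isMinOn' hS hw₀
    ((h2.eventually_ge_atTop _).filter_mono inf_le_left)
  refine ⟨w, ⟨hwS, hw⟩, fun w' hw' => hL ?_⟩
  have h4 := IsSolution.inner_le_of_leastSquares hφ ⟨hwS, hw⟩ hw'.1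
  have h5 := IsSolution.inner_le_of_leastSquares hφ hw' hwS
  have h6 : ⟪b - L w, L (w' - w)⟫_ℝ + ⟪b - L w', L (w - w')⟫_ℝ = ‖L w' - L w‖ ^ 2 := by
    rw [← neg_sub w' w, map_neg, inner_neg_right, ← sub_eq_add_neg, ← inner_sub_left,
      sub_sub_sub_cancel_left, map_sub, real_inner_self_eq_norm_sq]
  have h7 : ‖L w' - L w‖ ^ 2 = 0 := le_antisymm (by linarith) (by positivity)
  rwa [sq_eq_zero_iff, norm_eq_zero, sub_eq_zero] at h7

end PenalizedLeastSquares

section Matrices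

variable {m n : ℕ}

theorem mixedNorm_two_one (W : Matrix (Fin m) (Fin n) ℝ) :
    mixedNorm 2 1 W = ∑ i, ‖WithLp.toLp 2 (W i)‖ := by
  rw [mixedNorm, PiLp.norm_eq_of_L1]
  simp

theorem mem_rowBall_iff {r : ℝ} (hr : 0 ≤ r) (W : Matrix (Fin n) (Fin n) ℝ) :
    W ∈ rowBall n r ↔ ∀ i, WithLp.toLp 2 (W i) ∈ Metric.closedBall 0 r := by
  simp only [rowBall, mixedNorm, Set.mem_ofPred_eq, PiLp.norm_toLp, pi_norm_le_iff_of_nonneg hr,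
    norm_norm, mem_closedBall_zero_iff]

/-- The entries of a matrix as a Euclidean vector. -/
def vec : Matrix (Fin m) (Fin n) ℝ →ₗ[ℝ] EuclideanSpace ℝ (Fin m × Fin n) where
  toFun M := WithLp.toLp 2 fun p => M p.1 p.2
  map_add' _ _ := rfl
  map_smul' _ _ := rfl

@[simp]
theorem vec_apply (M : Matrix (Fin m) (Fin n) ℝ) (p : Fin m × Fin n) :
    (vec M).ofLp p = M p.1 p.2 := rfl

theorem vec_injective : Function.Injective (vec (m := m) (n := n)) := by
  intro M N h
  ext i j
  exact congrFun (congrArg WithLp.ofLp h) (i, j)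

theorem norm_vec (M : Matrix (Fin m) (Fin n) ℝ) : ‖vec M‖ = frobNorm M := by
  rw [frobNorm, Matrix.frobenius_norm_def, EuclideanSpace.norm_eq, Real.sqrt_eq_rpow,
    Fintype.sum_prod_type]
  simp

theorem inner_vec (M N : Matrix (Fin m) (Fin n) ℝ) :
    ⟪vec M, vec N⟫_ℝ = (M.transpose * N).trace := by
  simp only [vec_apply, PiLp.inner_apply, Fintype.sum_prod_type,
    Matrix.trace, Matrix.diag, Matrix.mul_apply, Matrix.transpose_apply]
  rw [Finset.sum_comm]
  simp [mul_comm]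

/-- A row of a matrix as a Euclidean vector. -/
def row (i : Fin m) : Matrix (Fin m) (Fin n) ℝ →ₗ[ℝ] EuclideanSpace ℝ (Fin n) where
  toFun M := WithLp.toLp 2 (M i)
  map_add' _ _ := rfl
  map_smul' _ _ := rfl

@[simp]
theorem row_apply (i : Fin m) (M : Matrix (Fin m) (Fin n) ℝ) (j : Fin n) :
    (row i M).ofLp j = M i j := rfl

theorem inner_vec_eq_sum_row (M N : Matrix (Fin m) (Fin n) ℝ) :
    ⟪vec M, vec N⟫_ℝ = ∑ i, ⟪row i M, row i N⟫_ℝ := by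
  simp [PiLp.inner_apply, Fintype.sum_prod_type]

theorem inner_vec_mul (A : Matrix (Fin m) (Fin n) ℝ) {l : ℕ} (M : Matrix (Fin m) (Fin l) ℝ)
    (D : Matrix (Fin n) (Fin l) ℝ) :
    ⟪vec M, vec (A * D)⟫_ℝ = ⟪vec (A.transpose * M), vec D⟫_ℝ := by
  rw [inner_vec, inner_vec, Matrix.transpose_mul, Matrix.transpose_transpose, Matrix.mul_assoc]

/-- The objective `½ ‖A W - B‖²_Fro + ε ‖W‖_{2,1}`, with the rows of `W` constrained to a closed
convex set, has a unique minimiser, which satisfies a variational inequality in each row. -/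
theorem multiTaskLasso_rowwise {ε : ℝ} (hε : 0 ≤ ε) {A B : Matrix (Fin m) (Fin n) ℝ}
    {V : Matrix (Fin n) (Fin n) ℝ} (hV : IsUnit V.det) (hAB : A.transpose * B = V)
    {C : Set (EuclideanSpace ℝ (Fin n))} (hC : IsClosed C) (hCc : Convex ℝ C) (hC0 : 0 ∈ C)
    {S : Set (Matrix (Fin n) (Fin n) ℝ)} (hS : ∀ W, W ∈ S ↔ ∀ i, row i W ∈ C) :
    (∃! W, IsSolution (multiTaskLasso ε A B) S W) ∧
      ∀ W, IsSolution (multiTaskLasso ε A B) S W → (∀ i, row i W ∈ C) ∧ ∀ i, ∀ w ∈ C,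
        ⟪row i (V - A.transpose * A * W), w - row i W⟫_ℝ ≤ ε * ‖w‖ - ε * ‖row i W‖ := by
  let _ := Matrix.frobeniusNormedAddCommGroup (m := Fin n) (n := Fin n) (α := ℝ)
  let _ := Matrix.frobeniusNormedSpace (R := ℝ) (m := Fin n) (n := Fin n) (α := ℝ)
  let L : Matrix (Fin n) (Fin n) ℝ →ₗ[ℝ] EuclideanSpace ℝ (Fin m × Fin n) :=
    vec ∘ₗ { toFun := fun W => A * W
             map_add' := Matrix.mul_add A
             map_smul' := fun a W => Matrix.mul_smul A a W }
  have hLapp : ∀ W, L W = vec (A * W) := fun W => rfl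
  have hL : Function.Injective L := by
    rw [injective_iff_map_eq_zero]
    intro W hW
    have h1 : A * W = 0 := vec_injective (by rw [← hLapp, hW, map_zero])
    have h2 : V.transpose * W = 0 := by
      rw [← hAB, Matrix.transpose_mul, Matrix.transpose_transpose, Matrix.mul_assoc, h1,
        Matrix.mul_zero]
    have h3 : IsUnit V.transpose.det := by rwa [Matrix.det_transpose]
    rw [← Matrix.nonsing_inv_mul_cancel_left V.transpose W h3, h2, Matrix.mul_zero]
  let φ : Matrix (Fin n) (Fin n) ℝ → ℝ := fun W => ε * ∑ i, ‖row i W‖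
  have hf : multiTaskLasso ε A B = fun W => 1 / 2 * ‖L W - vec B‖ ^ 2 + φ W := by
    funext W
    rw [hLapp, ← map_sub, norm_vec, multiTaskLasso, mixedNorm_two_one]
    rfl
  have hrow : ∀ i, Continuous fun W : Matrix (Fin n) (Fin n) ℝ => row i W := fun i =>
    (row i).continuous_of_finiteDimensional
  have hSeq : S = ⋂ i, (row i) ⁻¹' C := by
    ext W
    simp [hS]
  have hSclosed : IsClosed S := by
    rw [hSeq]
    exact isClosed_iInter fun i => hC.preimage (hrow i)
  have hSconv : Convex ℝ S := by
    rw [hSeq]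
    exact convex_iInter fun i => hCc.linear_preimage (row i)
  have hφ : ConvexOn ℝ S φ := by
    refine ⟨hSconv, fun U _ W _ a b ha hb _ => ?_⟩
    simp only [φ, smul_eq_mul]
    have : ∑ i, ‖row i (a • U + b • W)‖ ≤ a * ∑ i, ‖row i U‖ + b * ∑ i, ‖row i W‖ := by
      rw [Finset.mul_sum, Finset.mul_sum, ← Finset.sum_add_distrib]
      refine Finset.sum_le_sum fun i _ => ?_
      rw [map_add, map_smul, map_smul]
      refine (norm_add_le _ _).trans_eq ?_
      rw [norm_smul, norm_smul, Real.norm_of_nonneg ha, Real.norm_of_nonneg hb]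
    nlinarith
  have hφc : Continuous φ := by fun_prop
  rw [hf]
  refine ⟨existsUnique_isSolution_leastSquares_add hL (vec B) hSclosed
    ⟨0, (hS 0).2 fun i => by simpa using hC0⟩ hφ hφc fun W => by positivity, fun W hW => ?_⟩
  have hWC := (hS W).1 hW.1
  refine ⟨hWC, fun i w hw => ?_⟩
  set W' : Matrix (Fin n) (Fin n) ℝ := W.updateRow i w.ofLp with hW'
  have hii : row i W' = w := by
    ext j
    simp [hW']
  have hij : ∀ j, j ≠ i → row j W' = row j W := by
    intro j hj
    ext l
    simp [hW', Matrix.updateRow_ne hj]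
  have hW'S : W' ∈ S := by
    refine (hS W').2 fun j => ?_
    rcases eq_or_ne j i with rfl | hj
    · rwa [hii]
    · rw [hij j hj]
      exact hWC j
  have h1 := IsSolution.inner_le_of_leastSquares hφ hW hW'S
  rw [hLapp, hLapp, ← map_sub, inner_vec_mul, Matrix.mul_sub, hAB, ← Matrix.mul_assoc,
    inner_vec_eq_sum_row, Finset.sum_eq_single i, map_sub (row i) W', hii] at h1
  · have h2 : φ W' - φ W = ε * ‖w‖ - ε * ‖row i W‖ := by
      simp only [φ]
      rw [← mul_sub, ← mul_sub, ← Finset.sum_sub_distrib, Finset.sum_eq_single i, hii]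
      · intro j _ hj
        rw [hij j hj, sub_self]
      · simp
    rwa [h2] at h1
  · intro j _ hj
    rw [map_sub (row j) W', hij j hj, sub_self, inner_zero_right]
  · simp

end Matrices

section Primal

variable {X Y H : Type*} [NormedAddCommGroup Y] [InnerProductSpace ℝ Y] [CompleteSpace Y]
  [NormedAddCommGroup H] [InnerProductSpace ℝ H] [CompleteSpace H] [RKHS ℝ H X Y] {n : ℕ}

/-- If `-α i` is a subgradient of the loss at the `i`-th residual of `h = (Λ n)⁻¹ ∑ 𝒦(·, x_i) α_i`,
then `h` is the unique minimiser of the regularised empirical risk. -/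
theorem isSolution_regRisk_iff (hn : 0 < n) {ℓ : Y → ℝ} {Λ : ℝ} (hΛ : 0 < Λ) {x : Fin n → X}
    {y : Fin n → Y} {α : Fin n → Y} {h : H}
    (hh : h = (1 / (Λ * n)) • ∑ i, RKHS.kerFun H (x i) (α i))
    (hα : ∀ i v, ℓ (h (x i) - y i) ≤ ℓ v + ⟪α i, v - (h (x i) - y i)⟫_ℝ) (g : H) :
    IsSolution (regRisk ℓ Λ x y) Set.univ g ↔ g = h := by
  have hn' : (0 : ℝ) < n := by exact_mod_cast hn
  have key : ∀ g : H, regRisk ℓ Λ x y h + Λ / 2 * ‖g - h‖ ^ 2 ≤ regRisk ℓ Λ x y g := by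
    intro g
    have h1 : Λ * ⟪h, g - h⟫_ℝ = 1 / (n : ℝ) * ∑ i, ⟪α i, g (x i) - h (x i)⟫_ℝ := by
      nth_rewrite 1 [hh]
      rw [inner_smul_left, sum_inner]
      simp only [RKHS.kerFun_inner, RKHS.coe_sub, Pi.sub_apply, conj_trivial]
      field_simp
    have h2 : ∑ i, ℓ (h (x i) - y i) ≤
        ∑ i, ℓ (g (x i) - y i) + ∑ i, ⟪α i, g (x i) - h (x i)⟫_ℝ := by
      rw [← Finset.sum_add_distrib]
      refine Finset.sum_le_sum fun i _ => ?_
      simpa using hα i (g (x i) - y i)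
    have h3 := mul_le_mul_of_nonneg_left h2 (show 0 ≤ 1 / (n : ℝ) by positivity)
    rw [mul_add, ← h1] at h3
    have h4 : ‖g‖ ^ 2 = ‖h‖ ^ 2 + 2 * ⟪h, g - h⟫_ℝ + ‖g - h‖ ^ 2 := by
      rw [← norm_add_sq_real, add_sub_cancel]
    simp only [regRisk]
    rw [h4]
    linarith
  constructor
  · intro hg
    have h1 := key g
    have h2 : regRisk ℓ Λ x y g ≤ regRisk ℓ Λ x y h := hg.2 (Set.mem_univ h)
    have h3 : ‖g - h‖ ^ 2 ≤ 0 := by nlinarith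
    have h4 : ‖g - h‖ = 0 := by
      rw [← sq_eq_zero_iff]
      exact le_antisymm h3 (by positivity)
    rwa [norm_eq_zero, sub_eq_zero] at h4
  · rintro rfl
    refine ⟨Set.mem_univ _, fun g' _ => ?_⟩
    refine (le_add_of_nonneg_right ?_).trans (key g')
    positivity

end Primal

section Duality

variable {Y : Type*} [NormedAddCommGroup Y] [InnerProductSpace ℝ Y] {n : ℕ}

/-- The linear map sending the rows of `V` to the outputs `y_i`. -/
def rowsToOutputs (V : Matrix (Fin n) (Fin n) ℝ) (y : Fin n → Y) :
    EuclideanSpace ℝ (Fin n) →ₗ[ℝ] Y where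
  toFun w := ∑ j, (Matrix.vecMul w.ofLp V⁻¹) j • y j
  map_add' w w' := by simp [Matrix.add_vecMul, add_smul, Finset.sum_add_distrib]
  map_smul' a w := by simp [Matrix.smul_vecMul, mul_smul, Finset.smul_sum]

theorem rowsToOutputs_row (V : Matrix (Fin n) (Fin n) ℝ) (y : Fin n → Y)
    (W : Matrix (Fin n) (Fin n) ℝ) (i : Fin n) :
    rowsToOutputs V y (row i W) = ∑ j, (W * V⁻¹) i j • y j := rfl

theorem rowsToOutputs_row_self {V : Matrix (Fin n) (Fin n) ℝ} (hV : IsUnit V.det) (y : Fin n → Y)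
    (i : Fin n) : rowsToOutputs V y (row i V) = y i := by
  rw [rowsToOutputs_row, Matrix.mul_nonsing_inv V hV]
  simp [Matrix.one_apply]

theorem inner_rowsToOutputs {V : Matrix (Fin n) (Fin n) ℝ} (hV : IsUnit V.det) {y : Fin n → Y}
    (hVY : V * V.transpose = outputGram y) (w w' : EuclideanSpace ℝ (Fin n)) :
    ⟪rowsToOutputs V y w, rowsToOutputs V y w'⟫_ℝ = ⟪w, w'⟫_ℝ := by
  have h1 : ∀ a b : Fin n → ℝ, ⟪∑ j, a j • y j, ∑ j, b j • y j⟫_ℝ =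
      dotProduct (Matrix.vecMul a V) (Matrix.vecMul b V) := by
    intro a b
    rw [← Matrix.mulVec_transpose V b, Matrix.dotProduct_mulVec, Matrix.vecMul_vecMul, hVY,
      dotProduct, sum_inner]
    simp only [inner_sum, inner_smul_left, inner_smul_right, conj_trivial, Matrix.vecMul,
      dotProduct, outputGram, Matrix.of_apply, Finset.sum_mul]
    rw [Finset.sum_comm]
    refine Finset.sum_congr rfl fun i _ => Finset.sum_congr rfl fun j _ => ?_
    ring
  change ⟪∑ j, _ • y j, ∑ j, _ • y j⟫_ℝ = _
  rw [h1, Matrix.vecMul_vecMul, Matrix.vecMul_vecMul, Matrix.nonsing_inv_mul V hV,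
    Matrix.vecMul_one, Matrix.vecMul_one, EuclideanSpace.inner_eq_star_dotProduct, dotProduct_comm]
  simp

theorem norm_rowsToOutputs {V : Matrix (Fin n) (Fin n) ℝ} (hV : IsUnit V.det) {y : Fin n → Y}
    (hVY : V * V.transpose = outputGram y) (w : EuclideanSpace ℝ (Fin n)) :
    ‖rowsToOutputs V y w‖ = ‖w‖ := by
  rw [← sq_eq_sq₀ (norm_nonneg _) (norm_nonneg _), ← real_inner_self_eq_norm_sq,
    ← real_inner_self_eq_norm_sq, inner_rowsToOutputs hV hVY]

/-- Strong duality for a loss `ℓ` with Fenchel conjugate `ε ‖·‖ + (c / 2) ‖·‖²`, restricted to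
the norms attained on `C`. -/
theorem duality {X H : Type*} [CompleteSpace Y] [NormedAddCommGroup H] [InnerProductSpace ℝ H]
    [CompleteSpace H] [RKHS ℝ H X Y] {k : X → X → ℝ}
    (hK : ∀ s t, RKHS.kernel H s t = k s t • ContinuousLinearMap.id ℝ Y)
    (hn : 0 < n) (x : Fin n → X) {y : Fin n → Y} {Λ : ℝ} (hΛ : 0 < Λ)
    {V : Matrix (Fin n) (Fin n) ℝ} (hV : IsUnit V.det) (hVY : V * V.transpose = outputGram y)
    {ε c : ℝ} (hε : 0 ≤ ε) (hc : 0 ≤ c) {m : ℕ} {A B : Matrix (Fin m) (Fin n) ℝ}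
    (hA : A.transpose * A = (1 / (Λ * n)) • inputGram k x + c • (1 : Matrix (Fin n) (Fin n) ℝ))
    (hAB : A.transpose * B = V) {C : Set (EuclideanSpace ℝ (Fin n))} (hC : IsClosed C)
    (hCc : Convex ℝ C) (hC0 : 0 ∈ C) {S : Set (Matrix (Fin n) (Fin n) ℝ)}
    (hS : ∀ W, W ∈ S ↔ ∀ i, row i W ∈ C) {ℓ : Y → ℝ} (hℓ : ∀ u, ℓ (-u) = ℓ u)
    (hle : ∀ w ∈ C, ∀ α v : Y, ‖α‖ = ‖w‖ → ⟪α, v⟫_ℝ ≤ ℓ v + (ε * ‖w‖ + c / 2 * ‖w‖ ^ 2))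
    (hex : ∀ (r : EuclideanSpace ℝ (Fin n)) (u : Y), ‖u‖ = ‖r‖ →
      ∃ w ∈ C, ℓ u + (ε * ‖w‖ + c / 2 * ‖w‖ ^ 2) ≤ ⟪r, w⟫_ℝ) :
    (∃! W, IsSolution (multiTaskLasso ε A B) S W) ∧
      ∀ W, IsSolution (multiTaskLasso ε A B) S W → ∀ h : H,
        IsSolution (regRisk ℓ Λ x y) Set.univ h ↔ h = doubleExpansion H Λ x y (W * V⁻¹) := by
  obtain ⟨hex_unique, hrows⟩ := multiTaskLasso_rowwise hε hV hAB hC hCc hC0 hS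
  refine ⟨hex_unique, fun W hW h => ?_⟩
  obtain ⟨hWC, hvar⟩ := hrows W hW
  set T := rowsToOutputs V y with hT
  have hexp : doubleExpansion H Λ x y (W * V⁻¹) =
      (1 / (Λ * n)) • ∑ i, RKHS.kerFun H (x i) (T (row i W)) := by
    simp only [doubleExpansion, hT, rowsToOutputs_row, map_sum]
  set g : H := doubleExpansion H Λ x y (W * V⁻¹) with hg
  have hres : ∀ i, g (x i) - y i =
      -T (row i (V - ((1 / (Λ * n)) • inputGram k x) * W)) := by
    intro i
    have h1 : row i ((inputGram k x) * W) = ∑ j, k (x i) (x j) • row j W := by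
      ext l
      simp [Matrix.mul_apply, inputGram]
    have h2 : g (x i) = (1 / (Λ * n)) • ∑ j, k (x i) (x j) • T (row j W) := by
      rw [hexp, RKHS.coe_smul, Pi.smul_apply, ← RKHS.adjoint_kerFun, map_sum]
      simp only [RKHS.adjoint_kerFun, RKHS.kerFun_apply, hK]
      rfl
    rw [map_sub, map_sub, hT, rowsToOutputs_row_self hV, Matrix.smul_mul, map_smul, h1, map_smul,
      map_sum, h2]
    simp only [map_smul]
    abel
  refine isSolution_regRisk_iff hn hΛ hexp (fun i v => ?_) h
  set r := row i (V - ((1 / (Λ * n)) • inputGram k x) * W) with hr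
  set w := row i W with hw
  have hR : row i (V - A.transpose * A * W) = r - c • w := by
    rw [hA, hr, hw, Matrix.add_mul, Matrix.smul_mul c, Matrix.one_mul, ← sub_sub, map_sub (row i),
      map_smul]
  obtain ⟨w', hw'C, hw'⟩ := hex r (T r) (norm_rowsToOutputs hV hVY r)
  have h1 := hvar i w' hw'C
  rw [hR, inner_sub_left, inner_sub_right r, inner_smul_left, inner_sub_right w,
    real_inner_self_eq_norm_sq] at h1
  simp only [conj_trivial] at h1
  have h2 : c * (⟪w, w'⟫_ℝ - ‖w‖ ^ 2) ≤ c / 2 * ‖w'‖ ^ 2 - c / 2 * ‖w‖ ^ 2 := by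
    have h3 : 0 ≤ c * ‖w' - w‖ ^ 2 := by positivity
    rw [norm_sub_sq_real, real_inner_comm] at h3
    linarith
  have h4 := hle w (hWC i) (T w) (-v) (norm_rowsToOutputs hV hVY w)
  have h5 : ⟪T w, T r⟫_ℝ = ⟪r, w⟫_ℝ := by
    rw [hT, inner_rowsToOutputs hV hVY, real_inner_comm]
  rw [hℓ, inner_neg_right] at h4
  rw [hres i, hℓ, sub_neg_eq_add, inner_add_right, h5]
  linarith

end Duality

section Conjugates

theorem exists_norm_eq_inner_eq {E : Type*} [NormedAddCommGroup E] [InnerProductSpace ℝ E] {r : E}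
    (hr : 0 < ‖r‖) {t : ℝ} (ht : 0 ≤ t) : ∃ w : E, ‖w‖ = t ∧ ⟪r, w⟫_ℝ = ‖r‖ * t := by
  refine ⟨(t / ‖r‖) • r, ?_, ?_⟩
  · rw [norm_smul, Real.norm_of_nonneg (by positivity), div_mul_cancel₀ _ hr.ne']
  · rw [inner_smul_right, real_inner_self_eq_norm_sq]
    field_simp

end Conjugates

end DualOVK

end

theorem mainTheorem2
    {X Y H : Type*} [NormedAddCommGroup Y] [InnerProductSpace ℝ Y] [CompleteSpace Y]
    [NormedAddCommGroup H] [InnerProductSpace ℝ H] [CompleteSpace H] [RKHS ℝ H X Y]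
    (k : X → X → ℝ)
    (hK : ∀ s t, RKHS.kernel H s t = k s t • ContinuousLinearMap.id ℝ Y)
    (n : ℕ) (hn : 0 < n) (x : Fin n → X) (y : Fin n → Y) (Λ : ℝ) (hΛ : 0 < Λ)
    (V : Matrix (Fin n) (Fin n) ℝ) (hV : IsUnit V.det)
    (hVY : V * V.transpose = DualOVK.outputGram y) :
    -- ε-insensitive Ridge regression
    (∀ (ε : ℝ), 0 < ε → ∀ (m : ℕ) (A B : Matrix (Fin m) (Fin n) ℝ),
      A.transpose * A = (1 / (Λ * n)) • DualOVK.inputGram k x + 1 →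
      A.transpose * B = V →
      (∃! W, DualOVK.IsSolution (DualOVK.multiTaskLasso ε A B) Set.univ W) ∧
      ∀ W, DualOVK.IsSolution (DualOVK.multiTaskLasso ε A B) Set.univ W →
        ∀ h : H,
          DualOVK.IsSolution
            (DualOVK.regRisk (fun u => 1 / 2 * DualOVK.ridgeLoss ε u) Λ x y) Set.univ h ↔
          h = DualOVK.doubleExpansion H Λ x y (W * V⁻¹)) ∧
    -- κ-Huber regression
    (∀ (κ : ℝ), 0 < κ → ∀ (m : ℕ) (A B : Matrix (Fin m) (Fin n) ℝ),
      A.transpose * A = (1 / (Λ * n)) • DualOVK.inputGram k x + 1 →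
      A.transpose * B = V →
      (∃! W, DualOVK.IsSolution (DualOVK.leastSquares A B) (DualOVK.rowBall n κ) W) ∧
      ∀ W, DualOVK.IsSolution (DualOVK.leastSquares A B) (DualOVK.rowBall n κ) W →
        ∀ h : H,
          DualOVK.IsSolution (DualOVK.regRisk (DualOVK.huberLoss κ) Λ x y) Set.univ h ↔
          h = DualOVK.doubleExpansion H Λ x y (W * V⁻¹)) ∧
    -- ε-SVR
    (∀ (ε : ℝ), 0 < ε → ∀ (m : ℕ) (A B : Matrix (Fin m) (Fin n) ℝ),
      A.transpose * A = (1 / (Λ * n)) • DualOVK.inputGram k x →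
      A.transpose * B = V →
      (∃! W, DualOVK.IsSolution (DualOVK.multiTaskLasso ε A B) (DualOVK.rowBall n 1) W) ∧
      ∀ W, DualOVK.IsSolution (DualOVK.multiTaskLasso ε A B) (DualOVK.rowBall n 1) W →
        ∀ h : H,
          DualOVK.IsSolution (DualOVK.regRisk (DualOVK.svrLoss ε) Λ x y) Set.univ h ↔
          h = DualOVK.doubleExpansion H Λ x y (W * V⁻¹)) := by
  refine ⟨fun ε hε m A B hA hAB => ?_, fun κ hκ m A B hA hAB => ?_, fun ε hε m A B hA hAB => ?_⟩
  · refine DualOVK.duality hK hn x hΛ hV hVY hε.le zero_le_one (by rwa [one_smul]) hAB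
      isClosed_univ convex_univ (Set.mem_univ _) (by simp) (fun u => ?_) (fun w _ α v hα => ?_)
      (fun r u hu => ?_)
    · simp only [DualOVK.ridgeLoss_eq hε.le, norm_neg]
    · simp only [DualOVK.ridgeLoss_eq hε.le]
      have h1 := real_inner_le_norm α v
      rw [hα] at h1
      have h2 : ‖w‖ * ‖v‖ ≤ ‖w‖ * (max (‖v‖ - ε) 0 + ε) :=
        mul_le_mul_of_nonneg_left (by linarith [le_max_left (‖v‖ - ε) 0]) (norm_nonneg _)
      nlinarith [sq_nonneg (‖w‖ - max (‖v‖ - ε) 0)]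
    · simp only [DualOVK.ridgeLoss_eq hε.le, hu]
      rcases le_or_gt ‖r‖ ε with h | h
      · exact ⟨0, Set.mem_univ _, by simp [h]⟩
      · obtain ⟨w, hw, hrw⟩ := DualOVK.exists_norm_eq_inner_eq (hε.trans h) (sub_nonneg.2 h.le)
        refine ⟨w, Set.mem_univ _, ?_⟩
        rw [hw, hrw, max_eq_left (sub_nonneg.2 h.le)]
        linarith
  · have h0 : DualOVK.leastSquares A B = DualOVK.multiTaskLasso 0 A B := by
      funext W
      simp [DualOVK.leastSquares, DualOVK.multiTaskLasso]
    rw [h0]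
    refine DualOVK.duality hK hn x hΛ hV hVY le_rfl zero_le_one (by rwa [one_smul]) hAB
      Metric.isClosed_closedBall (convex_closedBall 0 κ) (Metric.mem_closedBall_self hκ.le)
      (DualOVK.mem_rowBall_iff hκ.le) (fun u => ?_) (fun w hw α v hα => ?_) (fun r u hu => ?_)
    · simp only [DualOVK.huberLoss_eq hκ.le, norm_neg]
    · rw [DualOVK.huberLoss_eq hκ.le]
      rw [mem_closedBall_zero_iff] at hw
      have h1 := real_inner_le_norm α v
      rw [hα] at h1
      split_ifs with h
      · nlinarith [sq_nonneg (‖w‖ - ‖v‖)]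
      · push Not at h
        nlinarith [mul_nonneg (sub_nonneg.2 hw) (sub_nonneg.2 h.le), sq_nonneg (κ - ‖w‖)]
    · rw [DualOVK.huberLoss_eq hκ.le, hu]
      split_ifs with h
      · refine ⟨r, mem_closedBall_zero_iff.2 h, ?_⟩
        rw [real_inner_self_eq_norm_sq]
        linarith
      · push Not at h
        obtain ⟨w, hw, hrw⟩ := DualOVK.exists_norm_eq_inner_eq (hκ.trans h) hκ.le
        refine ⟨w, mem_closedBall_zero_iff.2 hw.le, ?_⟩
        rw [hw, hrw]
        linarith
  · refine DualOVK.duality hK hn x hΛ hV hVY hε.le le_rfl (by rwa [zero_smul, add_zero]) hAB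
      Metric.isClosed_closedBall (convex_closedBall 0 1) (Metric.mem_closedBall_self zero_le_one)
      (DualOVK.mem_rowBall_iff zero_le_one) (fun u => ?_) (fun w hw α v hα => ?_)
      (fun r u hu => ?_)
    · simp only [DualOVK.svrLoss_eq hε.le, norm_neg]
    · rw [DualOVK.svrLoss_eq hε.le]
      rw [mem_closedBall_zero_iff] at hw
      have h1 := real_inner_le_norm α v
      rw [hα] at h1
      have h2 : ‖w‖ * ‖v‖ ≤ ‖w‖ * (max (‖v‖ - ε) 0 + ε) :=
        mul_le_mul_of_nonneg_left (by linarith [le_max_left (‖v‖ - ε) 0]) (norm_nonneg _)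
      have h3 : ‖w‖ * max (‖v‖ - ε) 0 ≤ 1 * max (‖v‖ - ε) 0 :=
        mul_le_mul_of_nonneg_right hw (le_max_right _ _)
      linarith
    · rw [DualOVK.svrLoss_eq hε.le, hu]
      rcases le_or_gt ‖r‖ ε with h | h
      · exact ⟨0, Metric.mem_closedBall_self zero_le_one, by simp [h]⟩
      · obtain ⟨w, hw, hrw⟩ := DualOVK.exists_norm_eq_inner_eq (hε.trans h) zero_le_one
        refine ⟨w, mem_closedBall_zero_iff.2 hw.le, ?_⟩
        rw [hw, hrw, max_eq_left (sub_nonneg.2 h.le)]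
        linarith
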